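/- Let $A\in\mathbb R^{m\times n}$ have columns $a_1,\dots,a_n$, and let $\lambda_1\ge\lambda_2\ge\dots\ge\lambda_n$ be the eigenvalues of $A^\top A$, counted with multiplicity. For $S\subseteq\{1,\dots,n\}$ let $P_S$ be the orthogonal projection onto $\mathrm{span}\{a_i: i\in S\}$ and put $\mathrm{Er}_A(S)=\|A-P_SA\|_F^2$, where $\|\cdot\|_F$ is the Frobenius norm. For an integer $k$ put $\mathrm{OPT}_k=\min_{B:\ \mathrm{rank}(B)=k}\|A-B\|_F^2$, the minimum being over $B\in\mathbb R^{m\times n}$. Let $k\text{-}\mathrm{DPP}(A^\top A)$ be the probability distribution on the subsets of $\{1,\dots,n\}$ of size $k$ under which $T$ has probability proportional to $\det\big((A^\top A)_{T,T}\big)$. For an integer $0\le s<\mathrm{rank}(A)$ let $\mathrm{sr}_s(A)=\lambda_{s+1}^{-1}\sum_{i>s}\lambda_i$ be the stable rank of order $s$. Theorem (Master Theorem). Let $s$ be an integer with $0\le s<\mathrm{rank}(A)$, let $t_s=s+\mathrm{sr}_s(A)$, let $0<\epsilon\le\frac12$, and let $k$ be an integer with $$s+\frac{7}{\epsilon^4}\ln^2\frac1\epsilon\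 \le\ k\ \le\ t_s-1 .$$ If $S\sim k\text{-}\mathrm{DPP}(A^\top A)$, then $\mathrm{OPT}_k>0$ and $$\frac{\mathbb E[\mathrm{Er}_A(S)]}{\mathrm{OPT}_k}\ \le\ (1+2\epsilon)^2\,\Phi_s(k),\qquad\text{where}\quad \Phi_s(k)=\Big(1+\frac{s}{k-s}\Big)\sqrt{1+\frac{2(k-s)}{t_s-k}} .$$ -/

import Mathlib

open MeasureTheory ProbabilityTheory
open scoped Matrix

noncomputable section

namespace CSSP

/-- The squared Frobenius norm of a real matrix. -/
def frobSq {m n : ℕ} (M : Matrix (Fin m) (Fin n) ℝ) : ℝ :=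
  (Matrix.frobeniusNormedAddCommGroup (m := Fin m) (n := Fin n) (α := ℝ)).toNorm.norm M ^ 2

/-- The subspace of Euclidean `ℝᵐ` spanned by the columns of `A` with index in `S`. -/
def colSpan {m n : ℕ} (A : Matrix (Fin m) (Fin n) ℝ) (S : Finset (Fin n)) :
    Submodule ℝ (EuclideanSpace ℝ (Fin m)) :=
  Submodule.span ℝ ((fun i : Fin n => WithLp.toLp 2 (A.col i)) '' (S : Set (Fin n)))

/-- The matrix `P_S` of the orthogonal projection onto the span of the columns of `A`
with index in `S`. -/
def projMatrix {m n : ℕ} (A : Matrix (Fin m) (Fin n) ℝ) (S : Finset (Fin n)) :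
    Matrix (Fin m) (Fin m) ℝ :=
  (Matrix.toEuclideanCLM (n := Fin m) (𝕜 := ℝ)).symm (colSpan A S).starProjection

/-- The column subset selection error `Er_A(S) = ‖A - P_S A‖_F²`. -/
def Er {m n : ℕ} (A : Matrix (Fin m) (Fin n) ℝ) (S : Finset (Fin n)) : ℝ :=
  frobSq (A - projMatrix A S * A)

/-- The best rank-`k` approximation error: the minimum of `‖A - B‖_F²` over the matrices `B` of
rank `k`, written as an infimum (it is attained whenever `k ≤ rank A`). -/
def OPT {m n : ℕ} (A : Matrix (Fin m) (Fin n) ℝ) (k : ℕ) : ℝ :=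
  sInf {x : ℝ | ∃ B : Matrix (Fin m) (Fin n) ℝ, B.rank = k ∧ frobSq (A - B) = x}

theorem isHermitian_gram {m n : ℕ} (A : Matrix (Fin m) (Fin n) ℝ) : (Aᵀ * A).IsHermitian := by
  have h := Matrix.isHermitian_conjTranspose_mul_self A
  rwa [Matrix.conjTranspose_eq_transpose_of_trivial] at h

/-- The eigenvalues of `AᵀA` in nonincreasing order, with multiplicity. The sequence is indexed
from zero, so that `eig A i` is `λ_{i+1}`, and it is extended by `0` beyond the size `n`. -/
def eig {m n : ℕ} (A : Matrix (Fin m) (Fin n) ℝ) (i : ℕ) : ℝ :=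
  if h : i < Fintype.card (Fin n) then (isHermitian_gram A).eigenvalues₀ ⟨i, h⟩ else 0

/-- The stable rank of order `s`: `sr_s(A) = λ_{s+1}⁻¹ ∑_{i > s} λ_i`. -/
def stableRank {m n : ℕ} (A : Matrix (Fin m) (Fin n) ℝ) (s : ℕ) : ℝ :=
  (eig A s)⁻¹ * ∑ i ∈ Finset.Ico s n, eig A i

/-- The principal minor `det(K_{T,T})`. -/
def principalMinor {n : ℕ} (K : Matrix (Fin n) (Fin n) ℝ) (T : Finset (Fin n)) : ℝ :=
  (K.submatrix (fun i : T => (i : Fin n)) (fun i : T => (i : Fin n))).det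

/-- The distribution `k-DPP(K)` on subsets of `{1, …, n}`: it is supported on the subsets of size
`k`, and the probability of such a subset `T` is proportional to `det(K_{T,T})`. -/
def kDPP {n : ℕ} (k : ℕ) (K : Matrix (Fin n) (Fin n) ℝ) : Measure (Finset (Fin n)) :=
  ∑ T ∈ Finset.powersetCard k Finset.univ,
    ENNReal.ofReal
      (principalMinor K T / ∑ T' ∈ Finset.powersetCard k Finset.univ, principalMinor K T') •
    Measure.dirac T

/-- `Φ_s(k) = (1 + s / (k - s)) √(1 + 2 (k - s) / (t_s - k))`, where `t_s = s + sr_s(A)`. -/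
def Phi {m n : ℕ} (A : Matrix (Fin m) (Fin n) ℝ) (s k : ℕ) : ℝ :=
  (1 + (s : ℝ) / ((k : ℝ) - s)) *
    √(1 + 2 * ((k : ℝ) - s) / (((s : ℝ) + stableRank A s) - k))

end CSSP

end

namespace CSSP

/-! Let `e_j` be the elementary symmetric functions of the eigenvalues of `AᵀA`, and put `ρ =
e_{k+1}/e_k`. Adjoining a column to `T` multiplies the principal minor by the squared distance of
that column to the span, so summing over columns and sets bounds the expected error by `(k+1)ρ`
(`integral_Er_le`).

Log-concavity gives `k ≤ ∑ λ_i/(λ_i+ρ)` (`le_sum_div_add_esymm_ratio`). Put `l = k - s` and let `W`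
be the sum of the `λ_i` with `i > k`. Bounding the first `s` terms by `1`, the next `l` by their
largest possible value, and the rest by `W/ρ` leaves a quadratic inequality in `lρ`. It yields `lρ ≤
W√(1 + 2lλ_{s+1}/W)`, and `W ≥ λ_{s+1}(t_s - k)` turns the root into that of `Phi`
(`sub_mul_esymm_ratio_le`).

Finally `W ≤ OPT_k` (Eckart–Young), and the lower bound on `k` enters only through `k - s ≥ 1/ε`,
which absorbs `(k+1)/k` into `(1+2ε)²`. -/

/-! ### Elementary symmetric functions -/

/-- Double counting: each set of size `k + 1` arises once for each of its elements. -/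
theorem sum_insert_powersetCard_erase {ι : Type*} [DecidableEq ι] (s : Finset ι) (k : ℕ)
    (g : Finset ι → ℝ) :
    ∑ i ∈ s, ∑ T ∈ (s.erase i).powersetCard k, g (insert i T) =
      (k + 1) * ∑ T ∈ s.powersetCard (k + 1), g T := by
  have h : ∀ i ∈ s, ∑ T ∈ (s.erase i).powersetCard k, g (insert i T) =
      ∑ T ∈ s.powersetCard (k + 1), if i ∈ T then g T else 0 := by
    intro i hi
    rw [← Finset.sum_filter]
    refine Finset.sum_nbij' (fun T => insert i T) (fun T => T.erase i) ?_ ?_ ?_ ?_ ?_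
    · intro T hT
      rw [Finset.mem_powersetCard] at hT
      have hiT : i ∉ T := fun h => by simpa using hT.1 h
      simp only [Finset.mem_filter, Finset.mem_powersetCard, Finset.mem_insert_self, and_true]
      exact ⟨Finset.insert_subset hi (hT.1.trans (Finset.erase_subset _ _)),
        by rw [Finset.card_insert_of_notMem hiT, hT.2]⟩
    · intro T hT
      simp only [Finset.mem_filter, Finset.mem_powersetCard] at hT ⊢
      exact ⟨Finset.erase_subset_erase _ hT.1.1, by rw [Finset.card_erase_of_mem hT.2, hT.1.2]; rfl⟩
    · intro T hT
      rw [Finset.mem_powersetCard] at hT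
      exact Finset.erase_insert fun h => by simpa using hT.1 h
    · intro T hT
      exact Finset.insert_erase (Finset.mem_filter.mp hT).2
    · intro T _
      rfl
  rw [Finset.sum_congr rfl h, Finset.sum_comm, Finset.mul_sum]
  refine Finset.sum_congr rfl fun T hT => ?_
  rw [Finset.mem_powersetCard] at hT
  rw [← Finset.sum_filter, Finset.filter_mem_eq_inter, Finset.inter_eq_right.mpr hT.1,
    Finset.sum_const, hT.2]
  simp

/-- The elementary symmetric function of degree `k` in the numbers `x i`, `i ∈ s`. -/
def esymm {ι : Type*} (s : Finset ι) (x : ι → ℝ) (k : ℕ) : ℝ :=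
  ∑ T ∈ s.powersetCard k, ∏ i ∈ T, x i

theorem esymm_nonneg {ι : Type*} {s : Finset ι} {x : ι → ℝ} (hx : ∀ i ∈ s, 0 ≤ x i) (k : ℕ) :
    0 ≤ esymm s x k :=
  Finset.sum_nonneg fun _ hT => Finset.prod_nonneg fun i hi =>
    hx i ((Finset.mem_powersetCard.mp hT).1 hi)

theorem esymm_zero {ι : Type*} (s : Finset ι) (x : ι → ℝ) : esymm s x 0 = 1 := by
  simp [esymm]

theorem esymm_insert {ι : Type*} [DecidableEq ι] {s : Finset ι} {a : ι} (ha : a ∉ s)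
    (x : ι → ℝ) (k : ℕ) :
    esymm (insert a s) x (k + 1) = esymm s x (k + 1) + x a * esymm s x k := by
  unfold esymm
  rw [Finset.powersetCard_succ_insert ha, Finset.sum_union, Finset.sum_image, Finset.mul_sum]
  · congr 1
    refine Finset.sum_congr rfl fun T hT => ?_
    rw [Finset.prod_insert fun h => ha ((Finset.mem_powersetCard.mp hT).1 h)]
  · intro T hT U hU h
    have hT' : a ∉ T := fun h => ha ((Finset.mem_powersetCard.mp hT).1 h)
    have hU' : a ∉ U := fun h => ha ((Finset.mem_powersetCard.mp hU).1 h)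
    rw [← Finset.erase_insert hT', ← Finset.erase_insert hU']
    exact congrArg (Finset.erase · a) h
  · rw [Finset.disjoint_left]
    intro T hT hT'
    obtain ⟨U, -, rfl⟩ := Finset.mem_image.mp hT'
    exact ha ((Finset.mem_powersetCard.mp hT).1 (Finset.mem_insert_self _ _))

/-- Log-concavity of the elementary symmetric functions of nonnegative numbers. -/
theorem esymm_mul_esymm_succ_le {ι : Type*} (s : Finset ι) (x : ι → ℝ) :
    (∀ i ∈ s, 0 ≤ x i) → ∀ i j : ℕ, i ≤ j →
      esymm s x i * esymm s x (j + 1) ≤ esymm s x (i + 1) * esymm s x j := by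
  classical
  induction s using Finset.induction_on with
  | empty =>
    intro _ i j _
    have h : ∀ l, esymm (∅ : Finset ι) x (l + 1) = 0 := fun l => by
      unfold esymm
      rw [Finset.powersetCard_eq_empty.mpr (by simp), Finset.sum_empty]
    rw [h, h]
    simp
  | insert a s ha ih =>
    intro hx i j hij
    have hs : ∀ i ∈ s, 0 ≤ x i := fun i hi => hx i (Finset.mem_insert_of_mem hi)
    have ih := ih hs
    have h0 : 0 ≤ x a := hx a (Finset.mem_insert_self _ _)
    rcases i with _ | i
    · rcases j with _ | j
      · rw [zero_add, mul_comm]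
      · have h1 := ih 0 (j + 1) (Nat.zero_le _)
        have h2 := esymm_nonneg hs (j + 1)
        have h3 := mul_nonneg (mul_nonneg h0 h0) (esymm_nonneg hs j)
        rw [esymm_insert ha, esymm_insert ha, esymm_insert ha, esymm_zero, esymm_zero]
        have h4 := mul_nonneg h0 (mul_nonneg (esymm_nonneg hs 1) (esymm_nonneg hs j))
        rw [esymm_zero] at h1
        simp only [zero_add] at h1 ⊢
        nlinarith
    · obtain ⟨j, rfl⟩ : ∃ l, j = l + 1 := ⟨j - 1, by omega⟩
      have h1 := ih (i + 1) (j + 1) hij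
      have h2 := mul_le_mul_of_nonneg_left (ih i j (by omega)) (mul_nonneg h0 h0)
      -- The coefficient of `x a` needs index gap two, so the induction requires all `i ≤ j`;
      -- chaining products avoids dividing by a vanishing `esymm`.
      have h3 : esymm s x i * esymm s x (j + 2) ≤ esymm s x (i + 2) * esymm s x j := by
        rcases Nat.eq_or_lt_of_le (Nat.le_of_succ_le_succ hij) with h | h
        · rw [h, mul_comm]
        · exact (ih i (j + 1) (by omega)).trans (ih (i + 1) j (by omega))
      have h4 := mul_le_mul_of_nonneg_left h3 h0
      rw [esymm_insert ha, esymm_insert ha, esymm_insert ha, esymm_insert ha]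
      nlinarith

theorem sum_mul_esymm_erase {ι : Type*} [DecidableEq ι] (s : Finset ι) (x : ι → ℝ) (k : ℕ) :
    ∑ i ∈ s, x i * esymm (s.erase i) x k = (k + 1) * esymm s x (k + 1) := by
  unfold esymm
  rw [← sum_insert_powersetCard_erase]
  refine Finset.sum_congr rfl fun i _ => ?_
  rw [Finset.mul_sum]
  refine Finset.sum_congr rfl fun T hT => ?_
  rw [Finset.prod_insert fun h => by simpa using (Finset.mem_powersetCard.mp hT).1 h]

/-- If `ρ = e_{k+1} / e_k`, then the sum of the `x i / (x i + ρ)` is at least `k`. -/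
theorem le_sum_div_add_esymm_ratio {ι : Type*} (s : Finset ι) (x : ι → ℝ)
    (hx : ∀ i ∈ s, 0 ≤ x i) (k : ℕ) (hk : 0 < esymm s x k) (hk' : 0 < esymm s x (k + 1)) :
    (k : ℝ) ≤ ∑ i ∈ s, x i / (x i + esymm s x (k + 1) / esymm s x k) := by
  classical
  rcases k with _ | k
  · rw [Nat.cast_zero]
    exact Finset.sum_nonneg fun i hi =>
      div_nonneg (hx i hi) (add_nonneg (hx i hi) (div_pos hk' hk).le)
  have hρ := div_pos hk' hk
  have h := sum_mul_esymm_erase s x k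
  rw [← Nat.cast_succ, Nat.succ_eq_add_one] at h
  rw [← mul_le_mul_iff_left₀ hk, ← h, Finset.sum_mul]
  refine Finset.sum_le_sum fun i hi => ?_
  have hi0 := hx i hi
  have hr : ∀ j ∈ s.erase i, 0 ≤ x j := fun j hj => hx j (Finset.mem_of_mem_erase hj)
  have e1 := esymm_insert (Finset.notMem_erase i s) x (k + 1)
  have e0 := esymm_insert (Finset.notMem_erase i s) x k
  rw [Finset.insert_erase hi] at e0 e1
  have lc := esymm_mul_esymm_succ_le (s.erase i) x hr k (k + 1) (Nat.le_succ k)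
  rw [div_mul_eq_mul_div, le_div_iff₀ (add_pos_of_nonneg_of_pos hi0 hρ), mul_assoc]
  refine mul_le_mul_of_nonneg_left ?_ hi0
  rw [mul_add, mul_div_assoc', ← le_sub_iff_add_le', div_le_iff₀ hk]
  rw [e0, e1]
  nlinarith

/-! ### Column selection error and principal minors -/

theorem frobSq_eq_sum_entries {m n : ℕ} (M : Matrix (Fin m) (Fin n) ℝ) :
    frobSq M = ∑ i, ∑ j, M i j ^ 2 := by
  unfold frobSq
  let := Matrix.frobeniusNormedAddCommGroup (m := Fin m) (n := Fin n) (α := ℝ)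
  have h : 0 ≤ ∑ i, ∑ j, M i j ^ 2 :=
    Finset.sum_nonneg fun i _ => Finset.sum_nonneg fun j _ => sq_nonneg _
  change ‖M‖ ^ 2 = _
  rw [Matrix.frobenius_norm_def, ← Real.rpow_natCast, ← Real.rpow_mul]
  · simp
  · exact Finset.sum_nonneg fun i _ => Finset.sum_nonneg fun j _ => by positivity

theorem frobSq_eq_sum_col {m n : ℕ} (M : Matrix (Fin m) (Fin n) ℝ) :
    frobSq M = ∑ j, ‖WithLp.toLp 2 (M.col j)‖ ^ 2 := by
  rw [frobSq_eq_sum_entries, Finset.sum_comm]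
  simp [EuclideanSpace.norm_sq_eq]

theorem frobSq_eq_sum_row {m n : ℕ} (M : Matrix (Fin m) (Fin n) ℝ) :
    frobSq M = ∑ i, ‖WithLp.toLp 2 (M.row i)‖ ^ 2 := by
  rw [frobSq_eq_sum_entries]
  simp [EuclideanSpace.norm_sq_eq]

theorem Er_eq_sum {m n : ℕ} (A : Matrix (Fin m) (Fin n) ℝ) (S : Finset (Fin n)) :
    Er A S = ∑ j, ‖WithLp.toLp 2 (A.col j) -
      (colSpan A S).starProjection (WithLp.toLp 2 (A.col j))‖ ^ 2 := by
  unfold Er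
  rw [frobSq_eq_sum_col]
  refine Finset.sum_congr rfl fun j _ => ?_
  have h : (colSpan A S).starProjection (WithLp.toLp 2 (A.col j)) =
      WithLp.toLp 2 ((projMatrix A S * A).col j) := by
    have h1 : (colSpan A S).starProjection = Matrix.toEuclideanCLM (𝕜 := ℝ) (projMatrix A S) := by
      simp [projMatrix]
    rw [h1, Matrix.toEuclideanCLM_toLp]
    congr 1
  rw [h, ← WithLp.toLp_sub]
  rfl

theorem inner_col {m n : ℕ} (A : Matrix (Fin m) (Fin n) ℝ) (i j : Fin n) :
    inner ℝ (WithLp.toLp 2 (A.col i)) (WithLp.toLp 2 (A.col j)) = (Aᵀ * A) i j := by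
  simp [Matrix.mul_apply, PiLp.inner_apply, mul_comm]

theorem principalMinor_nonneg {m n : ℕ} (A : Matrix (Fin m) (Fin n) ℝ) (T : Finset (Fin n)) :
    0 ≤ principalMinor (Aᵀ * A) T := by
  have h := Matrix.posSemidef_conjTranspose_mul_self A
  rw [Matrix.conjTranspose_eq_transpose_of_trivial] at h
  exact (h.submatrix _).det_nonneg

/-- Schur complement: the coefficients of the projection solve the normal equations `G c = b`, so
the complement is the squared residual. -/
theorem principalMinor_insert {m n : ℕ} (A : Matrix (Fin m) (Fin n) ℝ) {T : Finset (Fin n)}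
    {i : Fin n} (hi : i ∉ T) (hT : principalMinor (Aᵀ * A) T ≠ 0) :
    principalMinor (Aᵀ * A) (insert i T) = principalMinor (Aᵀ * A) T *
      ‖WithLp.toLp 2 (A.col i) - (colSpan A T).starProjection (WithLp.toLp 2 (A.col i))‖ ^ 2 := by
  set a : Fin n → EuclideanSpace ℝ (Fin m) := fun j => WithLp.toLp 2 (A.col j) with ha
  set p := (colSpan A T).starProjection (a i) with hp
  have hmem : p ∈ Submodule.span ℝ (Set.range fun j : T => a j) := by
    have h : p ∈ colSpan A T := Submodule.starProjection_apply_mem _ _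
    unfold colSpan at h
    rwa [Set.image_eq_range] at h
  obtain ⟨c, hc⟩ := (Submodule.mem_span_range_iff_exists_fun ℝ).mp hmem
  have horth : ∀ j ∈ T, inner ℝ (a j) p = inner ℝ (a j) (a i) := by
    intro j hj
    have h1 : a j ∈ colSpan A T := Submodule.subset_span ⟨j, hj, rfl⟩
    have h2 := Submodule.starProjection_inner_eq_zero (K := colSpan A T) (a i) (a j) h1
    rw [real_inner_comm, inner_sub_right] at h2
    linarith
  have hpp : inner ℝ p (a i) = inner ℝ p p := by
    have h2 := Submodule.starProjection_inner_eq_zero (K := colSpan A T) (a i) p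
      (Submodule.starProjection_apply_mem _ _)
    rw [real_inner_comm, inner_sub_right] at h2
    linarith
  set G : Matrix T T ℝ := (Aᵀ * A).submatrix (fun i : T => (i : Fin n)) (fun i : T => (i : Fin n))
    with hG
  have hdet : IsUnit G.det := (show G.det ≠ 0 from hT).isUnit
  let : Invertible G := Matrix.invertibleOfIsUnitDet G hdet
  set b : Matrix T Unit ℝ := Matrix.of fun j _ => inner ℝ (a j) (a i) with hb
  have hGc : G * Matrix.of (fun j (_ : Unit) => c j) = b := by
    ext j u
    rw [hb, Matrix.of_apply, ← horth j j.2, ← hc, inner_sum, Matrix.mul_apply]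
    refine Finset.sum_congr rfl fun l _ => ?_
    rw [inner_smul_right, hG, Matrix.submatrix_apply, inner_col, Matrix.of_apply, mul_comm]
  have hblock : principalMinor (Aᵀ * A) (insert i T) =
      (Matrix.fromBlocks G b bᵀ (Matrix.of fun (_ _ : Unit) => inner ℝ (a i) (a i))).det := by
    let e : ↥(insert i T) ≃ T ⊕ Unit :=
      (Finset.subtypeInsertEquivOption hi).trans (Equiv.optionEquivSumPUnit _)
    unfold principalMinor
    rw [← Matrix.det_submatrix_equiv_self e.symm]
    congr 1
    ext x y
    rcases x with x | x <;> rcases y with y | y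
    · rfl
    · simp only [Matrix.fromBlocks_apply₁₂, hb, Matrix.of_apply, ha, inner_col]
      rfl
    · simp only [Matrix.fromBlocks_apply₂₁, hb, Matrix.transpose_apply, Matrix.of_apply, ha]
      rw [real_inner_comm, inner_col]
      rfl
    · simp only [Matrix.fromBlocks_apply₂₂, Matrix.of_apply, ha, inner_col]
      rfl
  rw [hblock, Matrix.det_fromBlocks₁₁, ← hGc, Matrix.mul_assoc, ← Matrix.mul_assoc (⅟G),
    invOf_mul_self, Matrix.one_mul, hGc]
  congr 1
  rw [Matrix.det_unique, Matrix.sub_apply, Matrix.mul_apply, ← real_inner_self_eq_norm_sq,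
    inner_sub_left, inner_sub_right, inner_sub_right, hpp, real_inner_comm p (a i), hpp]
  have h : ∑ j : T, bᵀ default j * Matrix.of (fun j (_ : Unit) => c j) j default =
      inner ℝ p p := by
    rw [← hpp, ← hc, sum_inner]
    refine Finset.sum_congr rfl fun j _ => ?_
    rw [inner_smul_left, Matrix.transpose_apply, hb]
    simp [mul_comm]
  rw [h, Matrix.of_apply]
  ring

theorem principalMinor_mul_Er_le {m n : ℕ} (A : Matrix (Fin m) (Fin n) ℝ) (T : Finset (Fin n)) :
    principalMinor (Aᵀ * A) T * Er A T ≤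
      ∑ i ∈ Tᶜ, principalMinor (Aᵀ * A) (insert i T) := by
  rcases eq_or_ne (principalMinor (Aᵀ * A) T) 0 with h | h
  · rw [h, zero_mul]
    exact Finset.sum_nonneg fun i _ => principalMinor_nonneg A _
  rw [Er_eq_sum, ← Finset.sum_add_sum_compl T, Finset.sum_eq_zero, zero_add, Finset.mul_sum]
  · exact (Finset.sum_congr rfl fun i hi =>
      (principalMinor_insert A (Finset.mem_compl.mp hi) h).symm).le
  · intro j hj
    have h1 : WithLp.toLp 2 (A.col j) ∈ colSpan A T := Submodule.subset_span ⟨j, hj, rfl⟩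
    rw [Submodule.starProjection_eq_self_iff.mpr h1]
    simp

theorem sum_principalMinor_mul_Er_le {m n : ℕ} (A : Matrix (Fin m) (Fin n) ℝ) (k : ℕ) :
    ∑ T ∈ Finset.powersetCard k Finset.univ, principalMinor (Aᵀ * A) T * Er A T ≤
      (k + 1) * ∑ T ∈ Finset.powersetCard (k + 1) Finset.univ, principalMinor (Aᵀ * A) T := by
  rw [← sum_insert_powersetCard_erase]
  refine (Finset.sum_le_sum fun T _ => principalMinor_mul_Er_le A T).trans (le_of_eq ?_)
  refine Finset.sum_comm' fun T i => ?_
  simp only [Finset.mem_powersetCard, Finset.mem_compl, Finset.mem_univ, and_true,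
    Finset.subset_univ, true_and, Finset.subset_erase]
  exact and_comm

/-! ### Spectrum of the Gram matrix -/

theorem exists_perm_eigenvalues {m n : ℕ} (A : Matrix (Fin m) (Fin n) ℝ) :
    ∃ σ : Equiv.Perm (Fin n), ∀ i : Fin n,
      (isHermitian_gram A).eigenvalues (σ i) = eig A i := by
  refine ⟨(finCongr (Fintype.card_fin n).symm).trans
    (Fintype.equivOfCardEq (Fintype.card_fin _)), fun i => ?_⟩
  have hi : (i : ℕ) < Fintype.card (Fin n) := by simp
  rw [Matrix.IsHermitian.eigenvalues, eig, dif_pos hi, Equiv.trans_apply, Equiv.symm_apply_apply]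
  rfl

theorem eig_antitone {m n : ℕ} (A : Matrix (Fin m) (Fin n) ℝ) {i j : ℕ} (hij : i ≤ j)
    (hj : j < n) : eig A j ≤ eig A i := by
  have hj' : j < Fintype.card (Fin n) := by simpa
  rw [eig, eig, dif_pos hj', dif_pos (hij.trans_lt hj')]
  exact (isHermitian_gram A).eigenvalues₀_antitone hij

theorem eig_nonneg {m n : ℕ} (A : Matrix (Fin m) (Fin n) ℝ) (i : ℕ) : 0 ≤ eig A i := by
  by_cases hi : i < n
  · obtain ⟨σ, hσ⟩ := exists_perm_eigenvalues A
    have h := Matrix.posSemidef_conjTranspose_mul_self A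
    rw [Matrix.conjTranspose_eq_transpose_of_trivial] at h
    exact (h.eigenvalues_nonneg _).trans_eq (hσ ⟨i, hi⟩)
  · rw [eig, dif_neg (by simpa using hi)]

/-- Both sides are, up to the sign `(-1)^k`, the coefficient of degree `n - k` in the characteristic
polynomial. -/
theorem sum_principalMinor {m n : ℕ} (A : Matrix (Fin m) (Fin n) ℝ) (k : ℕ) :
    ∑ T ∈ Finset.powersetCard k Finset.univ, principalMinor (Aᵀ * A) T =
      esymm (Finset.range n) (eig A) k := by
  rcases lt_or_ge n k with h | h
  · rw [esymm, Finset.powersetCard_eq_empty.mpr (by simpa), Finset.powersetCard_eq_empty.mpr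
      (by simpa), Finset.sum_empty, Finset.sum_empty]
  have h1 := Matrix.charpoly_coeff_eq_sum_minors (Aᵀ * A) k (by simpa)
  have h2 : (∏ i : Fin n, (Polynomial.X + Polynomial.C (-(isHermitian_gram A).eigenvalues i))).coeff
      (n - k) = _ := Finset.prod_X_add_C_coeff Finset.univ _ (by simp)
  have h3 : (Aᵀ * A).charpoly = _ := (isHermitian_gram A).charpoly_eq
  simp only [sub_eq_add_neg, ← Polynomial.C_neg] at h3
  rw [h3, Fintype.card_fin] at h1
  have h4 := h1.symm.trans h2
  rw [Finset.card_univ, Fintype.card_fin, Nat.sub_sub_self h] at h4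
  have h5 : ∑ T ∈ Finset.powersetCard k Finset.univ, principalMinor (Aᵀ * A) T =
      esymm Finset.univ (isHermitian_gram A).eigenvalues k := by
    refine mul_left_cancel₀ (pow_ne_zero k (neg_ne_zero.mpr (one_ne_zero (α := ℝ)))) (h4.trans ?_)
    rw [esymm, Finset.mul_sum]
    refine Finset.sum_congr rfl fun T hT => ?_
    rw [Finset.prod_neg, (Finset.mem_powersetCard.mp hT).2]
  obtain ⟨σ, hσ⟩ := exists_perm_eigenvalues A
  rw [h5, esymm, esymm, ← Finset.esymm_map_val, ← Finset.esymm_map_val]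
  congr 1
  have e1 : (Finset.range n).val = (Finset.univ : Finset (Fin n)).val.map Fin.val := by
    rw [← Nat.Iio_eq_range, ← Fin.map_valEmbedding_univ]
    rfl
  have e2 : (Finset.univ : Finset (Fin n)).val = (Finset.univ : Finset (Fin n)).val.map σ := by
    rw [← Finset.map_univ_equiv σ]
    simp
  conv_lhs => rw [e2]
  rw [e1, Multiset.map_map, Multiset.map_map]
  exact Multiset.map_congr rfl fun i _ => hσ i

/-! ### Eckart–Young lower bound -/

theorem norm_mulVec_sq_eq_sum {m n : ℕ} (A : Matrix (Fin m) (Fin n) ℝ)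
    (v : EuclideanSpace ℝ (Fin n)) :
    ‖Matrix.toEuclideanLin A v‖ ^ 2 = ∑ i, (isHermitian_gram A).eigenvalues i *
      inner ℝ ((isHermitian_gram A).eigenvectorBasis i) v ^ 2 := by
  set u := (isHermitian_gram A).eigenvectorBasis
  have h1 : ∀ w : EuclideanSpace ℝ (Fin n),
      inner ℝ (Matrix.toEuclideanLin A w) (Matrix.toEuclideanLin A v) =
        inner ℝ (Matrix.toEuclideanLin (Aᵀ * A) w) v := by
    intro w
    simp only [EuclideanSpace.inner_eq_star_dotProduct, Matrix.ofLp_toLpLin, Matrix.toLin'_apply,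
      star_trivial, ← Matrix.mulVec_mulVec]
    rw [Matrix.dotProduct_mulVec, Matrix.dotProduct_mulVec v.ofLp, Matrix.vecMul_transpose,
      ← Matrix.dotProduct_mulVec]
  have h2 : ∀ i, Matrix.toEuclideanLin (Aᵀ * A) (u i) =
      (isHermitian_gram A).eigenvalues i • u i := by
    intro i
    ext j
    have := congrFun ((isHermitian_gram A).mulVec_eigenvectorBasis i) j
    simpa using this
  rw [← real_inner_self_eq_norm_sq]
  have h3 : inner ℝ (Matrix.toEuclideanLin A v) (Matrix.toEuclideanLin A v) =
      inner ℝ (Matrix.toEuclideanLin A (∑ i, u.repr v i • u i)) (Matrix.toEuclideanLin A v) := by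
    rw [u.sum_repr]
  rw [h3, map_sum, sum_inner]
  refine Finset.sum_congr rfl fun i _ => ?_
  rw [map_smul, inner_smul_left, h1, h2, inner_smul_left, u.repr_apply_apply]
  simp
  ring

/-- Among weights in `[0, 1]` of total `n - k`, the indicator of the smallest values minimises the
weighted sum. -/
theorem sum_Ico_le_sum_mul {n : ℕ} (k : ℕ) (hk : k ≤ n) (f : ℕ → ℝ) (hf0 : ∀ i, 0 ≤ f i)
    (hf : ∀ i j, i ≤ j → j < n → f j ≤ f i) (d : Fin n → ℝ) (hd0 : ∀ i, 0 ≤ d i)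
    (hd1 : ∀ i, d i ≤ 1) (hd : ∑ i, d i = (n : ℝ) - k) :
    ∑ i ∈ Finset.Ico k n, f i ≤ ∑ i : Fin n, f i * d i := by
  rcases hk.eq_or_lt with rfl | hk
  · rw [Finset.Ico_self, Finset.sum_empty]
    exact Finset.sum_nonneg fun i _ => mul_nonneg (hf0 _) (hd0 i)
  have hfil : (Finset.range n).filter (k ≤ ·) = Finset.Ico k n := by
    ext i
    simp [and_comm]
  have e : ∀ g : ℕ → ℝ, ∑ i ∈ Finset.Ico k n, g i = ∑ i : Fin n, if k ≤ (i : ℕ) then g i else 0 := by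
    intro g
    rw [Fin.sum_univ_eq_sum_range (fun i => if k ≤ i then g i else 0), ← Finset.sum_filter, hfil]
  have e1 : ∑ i : Fin n, (if k ≤ (i : ℕ) then (1 : ℝ) else 0) = (n : ℝ) - k := by
    rw [← e fun _ => 1]
    simp [Nat.cast_sub hk.le]
  -- Both factors change sign at index `k`; subtracting `f k` costs nothing because the two weights
  -- have equal total.
  have h : 0 ≤ ∑ i : Fin n, (f i - f k) * (d i - if k ≤ (i : ℕ) then (1 : ℝ) else 0) := by
    refine Finset.sum_nonneg fun i _ => ?_
    split_ifs with h
    · exact mul_nonneg_of_nonpos_of_nonpos (sub_nonpos.mpr (hf k i h i.2)) (sub_nonpos.mpr (hd1 i))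
    · rw [sub_zero]
      exact mul_nonneg (sub_nonneg.mpr (hf i k (not_le.mp h).le hk)) (hd0 i)
  have h' : ∑ i : Fin n, (f i - f k) * (d i - if k ≤ (i : ℕ) then (1 : ℝ) else 0) =
      ∑ i : Fin n, f i * d i - (∑ i : Fin n, if k ≤ (i : ℕ) then f i else 0) -
        f k * (∑ i, d i - ∑ i : Fin n, if k ≤ (i : ℕ) then (1 : ℝ) else 0) := by
    rw [← Finset.sum_sub_distrib, ← Finset.sum_sub_distrib, Finset.mul_sum,
      ← Finset.sum_sub_distrib]
    refine Finset.sum_congr rfl fun i _ => ?_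
    split_ifs <;> ring
  rw [h', hd, e1, sub_self, mul_zero, sub_zero] at h
  rw [e f]
  linarith

/-- Bessel's inequality, row by row. -/
theorem sum_norm_mulVec_sq_le_frobSq {m n : ℕ} (M : Matrix (Fin m) (Fin n) ℝ) {ι : Type*}
    [Fintype ι] {v : ι → EuclideanSpace ℝ (Fin n)} (hv : Orthonormal ℝ v) :
    ∑ j, ‖Matrix.toEuclideanLin M (v j)‖ ^ 2 ≤ frobSq M := by
  rw [frobSq_eq_sum_row]
  simp only [EuclideanSpace.norm_sq_eq (Matrix.toEuclideanLin M _)]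
  rw [Finset.sum_comm]
  refine Finset.sum_le_sum fun i _ => ?_
  refine le_trans (le_of_eq ?_) (hv.sum_inner_products_le (s := Finset.univ) (WithLp.toLp 2 (M.row i)))
  refine Finset.sum_congr rfl fun j _ => ?_
  rw [EuclideanSpace.inner_eq_star_dotProduct]
  simp [Matrix.mulVec]
  rfl

/-- On `ker B` the matrix `A - B` acts as `A`. The weight of an eigenvalue is the squared projection
of its eigenvector onto `ker B`: at most `1` by Bessel, with total `dim ker B` by Parseval. -/
theorem sum_eig_le_frobSq_sub {m n : ℕ} (A B : Matrix (Fin m) (Fin n) ℝ) :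
    ∑ i ∈ Finset.Ico B.rank n, eig A i ≤ frobSq (A - B) := by
  set N := LinearMap.ker (Matrix.toEuclideanLin B)
  have hN : Module.finrank ℝ N + B.rank = n := by
    have h := (Matrix.toEuclideanLin B).finrank_range_add_finrank_ker
    have hr : B.rank = Module.finrank ℝ (LinearMap.range (Matrix.toEuclideanLin B)) :=
      B.rank_eq_finrank_range_toLin (PiLp.basisFun 2 ℝ (Fin m)) (PiLp.basisFun 2 ℝ (Fin n))
    rw [finrank_euclideanSpace, Fintype.card_fin, ← hr, add_comm] at h
    exact h
  let w := stdOrthonormalBasis ℝ N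
  have hv : Orthonormal ℝ fun j => (w j : EuclideanSpace ℝ (Fin n)) :=
    w.orthonormal.comp_linearIsometry N.subtypeₗᵢ
  obtain ⟨σ, hσ⟩ := exists_perm_eigenvalues A
  set u := (isHermitian_gram A).eigenvectorBasis with hu
  have h1 := sum_norm_mulVec_sq_le_frobSq (A - B) hv
  have h2 : ∀ j, Matrix.toEuclideanLin (A - B) (w j) = Matrix.toEuclideanLin A (w j) := by
    intro j
    rw [map_sub, LinearMap.sub_apply, LinearMap.mem_ker.mp (w j).2, sub_zero]
  simp only [h2, norm_mulVec_sq_eq_sum] at h1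
  rw [Finset.sum_comm, ← Equiv.sum_comp σ] at h1
  simp only [← Finset.mul_sum, hσ] at h1
  refine le_trans (sum_Ico_le_sum_mul B.rank (by omega) (eig A) (eig_nonneg A)
    (fun i j => eig_antitone A) _ (fun i => Finset.sum_nonneg fun j _ => sq_nonneg _)
    (fun i => ?_) ?_) h1
  · have h := hv.sum_inner_products_le (u (σ i)) (s := Finset.univ)
    rw [u.orthonormal.1, one_pow] at h
    refine le_trans (le_of_eq (Finset.sum_congr rfl fun j _ => ?_)) h
    rw [Real.norm_eq_abs, sq_abs, real_inner_comm]
  · rw [Finset.sum_comm]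
    have h : ∀ j, ∑ i, inner ℝ (u (σ i)) (w j : EuclideanSpace ℝ (Fin n)) ^ 2 = 1 := by
      intro j
      rw [Equiv.sum_comp σ fun i => inner ℝ (u i) (w j : EuclideanSpace ℝ (Fin n)) ^ 2]
      have h := u.sum_sq_norm_inner_right (w j : EuclideanSpace ℝ (Fin n))
      rw [hv.1, one_pow] at h
      simpa using h
    rw [Finset.sum_congr rfl fun j _ => h j]
    have := congrArg (Nat.cast (R := ℝ)) hN
    push_cast at this
    simp
    linarith

theorem exists_rank_eq {m n k : ℕ} (hm : k ≤ m) (hn : k ≤ n) :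
    ∃ B : Matrix (Fin m) (Fin n) ℝ, B.rank = k := by
  have hf := LinearMap.funLeft_surjective_of_injective ℝ ℝ _ (Fin.castLE_injective hn)
  have hg := LinearMap.funLeft_surjective_of_injective ℝ ℝ _ (Fin.castLE_injective hm)
  obtain ⟨g, hg⟩ := LinearMap.exists_rightInverse_of_surjective _ (LinearMap.range_eq_top.mpr hg)
  have hginj : Function.Injective g := fun x y h => by
    have := congrArg (LinearMap.funLeft ℝ ℝ (Fin.castLE hm)) h
    rwa [← LinearMap.comp_apply, ← LinearMap.comp_apply, hg] at this
  refine ⟨LinearMap.toMatrix' (g ∘ₗ LinearMap.funLeft ℝ ℝ (Fin.castLE hn)), ?_⟩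
  rw [Matrix.rank, ← Matrix.toLin'_apply', Matrix.toLin'_toMatrix',
    LinearMap.range_comp_of_range_eq_top _ (LinearMap.range_eq_top.mpr hf), LinearMap.finrank_range_of_inj hginj]
  simp

theorem le_rank_of_eig_pos {m n k : ℕ} (A : Matrix (Fin m) (Fin n) ℝ) (hn : k ≤ n)
    (h : ∀ i < k, 0 < eig A i) : k ≤ A.rank := by
  obtain ⟨σ, hσ⟩ := exists_perm_eigenvalues A
  have h1 := (isHermitian_gram A).rank_eq_card_non_zero_eigs
  rw [Matrix.rank_transpose_mul_self] at h1
  rw [h1, ← Fintype.card_fin k]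
  refine Fintype.card_le_of_injective (fun j : Fin k =>
    (⟨σ (Fin.castLE hn j), ?_⟩ : {i // (isHermitian_gram A).eigenvalues i ≠ 0})) ?_
  · rw [hσ]
    exact (h j j.2).ne'
  · intro i j hij
    exact Fin.castLE_injective hn (σ.injective (congrArg Subtype.val hij))

/-! ### Expected error under the k-DPP -/

theorem integral_kDPP {n : ℕ} (k : ℕ) (K : Matrix (Fin n) (Fin n) ℝ)
    (hK : ∀ T, 0 ≤ principalMinor K T) (f : Finset (Fin n) → ℝ) :
    ∫ T, f T ∂kDPP k K = (∑ T ∈ Finset.powersetCard k Finset.univ, principalMinor K T * f T) /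
      ∑ T ∈ Finset.powersetCard k Finset.univ, principalMinor K T := by
  unfold kDPP
  rw [integral_finsetSum_measure]
  · rw [Finset.sum_div]
    refine Finset.sum_congr rfl fun T _ => ?_
    rw [integral_smul_measure, integral_dirac, ENNReal.toReal_ofReal, smul_eq_mul]
    · ring
    · exact div_nonneg (hK T) (Finset.sum_nonneg fun T' _ => hK T')
  · intro T _
    exact (integrable_dirac (by simp)).smul_measure ENNReal.ofReal_ne_top

theorem integral_Er_le {m n : ℕ} (A : Matrix (Fin m) (Fin n) ℝ) (k : ℕ)
    {Ω : Type*} [MeasurableSpace Ω] (P : Measure Ω)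
    (S : Ω → Finset (Fin n)) (hS : HasLaw S (kDPP k (Aᵀ * A)) P) :
    ∫ ω, Er A (S ω) ∂P ≤ (k + 1) *
      (esymm (Finset.range n) (eig A) (k + 1) / esymm (Finset.range n) (eig A) k) := by
  have h : ∫ ω, Er A (S ω) ∂P = ∫ T, Er A T ∂kDPP k (Aᵀ * A) :=
    hS.integral_comp (f := Er A) (Measurable.of_discrete).aestronglyMeasurable
  rw [h, integral_kDPP _ _ (principalMinor_nonneg A), ← sum_principalMinor, ← sum_principalMinor,
    mul_div_assoc']
  exact div_le_div_of_nonneg_right (sum_principalMinor_mul_Er_le A k)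
    (Finset.sum_nonneg fun T _ => principalMinor_nonneg A T)

/-! ### Bounding the ratio of symmetric functions -/

theorem mul_stableRank_sub_le {m n s k : ℕ} (A : Matrix (Fin m) (Fin n) ℝ) (hsk : s ≤ k)
    (hkn : k ≤ n) (h0 : 0 < eig A s) :
    eig A s * (stableRank A s - (k - s)) ≤ ∑ i ∈ Finset.Ico k n, eig A i := by
  have h1 : eig A s * stableRank A s = ∑ i ∈ Finset.Ico s n, eig A i := by
    rw [stableRank, mul_inv_cancel_left₀ h0.ne']
  have h2 : ∑ i ∈ Finset.Ico s k, eig A i ≤ ∑ i ∈ Finset.Ico s k, eig A s :=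
    Finset.sum_le_sum fun i hi =>
      eig_antitone A (Finset.mem_Ico.mp hi).1 ((Finset.mem_Ico.mp hi).2.trans_le hkn)
  rw [Finset.sum_const, Nat.card_Ico, nsmul_eq_mul, Nat.cast_sub hsk] at h2
  rw [mul_sub, h1, ← Finset.sum_Ico_consecutive _ hsk hkn]
  linarith

theorem sub_mul_esymm_ratio_le {m n s k : ℕ} (A : Matrix (Fin m) (Fin n) ℝ) (hsk : s < k)
    (hkn : k ≤ n) (h0 : 0 < eig A s) (hsr : (k : ℝ) - s < stableRank A s) :
    ((k : ℝ) - s) *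
        (esymm (Finset.range n) (eig A) (k + 1) / esymm (Finset.range n) (eig A) k) ≤
      (∑ i ∈ Finset.Ico k n, eig A i) *
        √(1 + 2 * ((k : ℝ) - s) / (((s : ℝ) + stableRank A s) - k)) := by
  have hl : (0 : ℝ) < k - s := sub_pos.mpr (Nat.cast_lt.mpr hsk)
  have hW := mul_stableRank_sub_le A hsk.le hkn h0
  have hδ : 0 < stableRank A s - (k - s) := sub_pos.mpr hsr
  set W := ∑ i ∈ Finset.Ico k n, eig A i
  have hWpos : 0 < W := (mul_pos h0 hδ).trans_le hW
  have hx := eig_nonneg A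
  have hn : ∀ j, 0 ≤ esymm (Finset.range n) (eig A) j := esymm_nonneg fun i _ => hx i
  rcases (hn (k + 1)).eq_or_lt with hz | hp'
  · rw [← hz, zero_div, mul_zero]
    exact mul_nonneg hWpos.le (Real.sqrt_nonneg _)
  rcases (hn k).eq_or_lt with hz | hp
  · rw [← hz, div_zero, mul_zero]
    exact mul_nonneg hWpos.le (Real.sqrt_nonneg _)
  have hk := le_sum_div_add_esymm_ratio _ (eig A) (fun i _ => hx i) k hp hp'
  have hρ := div_pos hp' hp
  set ρ := esymm (Finset.range n) (eig A) (k + 1) / esymm (Finset.range n) (eig A) k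
  have hpos : ∀ i, 0 < eig A i + ρ := fun i => add_pos_of_nonneg_of_pos (hx i) hρ
  rw [Finset.range_eq_Ico, ← Finset.sum_Ico_consecutive _ (Nat.zero_le s) (hsk.le.trans hkn),
    ← Finset.sum_Ico_consecutive _ hsk.le hkn] at hk
  have b1 : ∑ i ∈ Finset.Ico 0 s, eig A i / (eig A i + ρ) ≤ s := by
    refine (Finset.sum_le_card_nsmul _ _ 1 fun i _ => ?_).trans_eq (by simp)
    exact (div_le_one (hpos i)).mpr (by linarith)
  have b2 : ∑ i ∈ Finset.Ico s k, eig A i / (eig A i + ρ) ≤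
      (k - s) * (eig A s / (eig A s + ρ)) := by
    refine (Finset.sum_le_card_nsmul _ _ (eig A s / (eig A s + ρ)) fun i hi => ?_).trans_eq
      (by rw [Nat.card_Ico, nsmul_eq_mul, Nat.cast_sub hsk.le])
    have h := eig_antitone A (Finset.mem_Ico.mp hi).1 ((Finset.mem_Ico.mp hi).2.trans_le hkn)
    rw [div_le_div_iff₀ (hpos i) (hpos s)]
    nlinarith
  have b3 : ∑ i ∈ Finset.Ico k n, eig A i / (eig A i + ρ) ≤ W / ρ := by
    rw [Finset.sum_div]
    exact Finset.sum_le_sum fun i _ =>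
      div_le_div_of_nonneg_left (hx i) hρ (le_add_of_nonneg_left (hx i))
  set l : ℝ := k - s
  -- The three bounds add up to `k ≤ s + l·λ_{s+1}/(λ_{s+1}+ρ) + W/ρ`; here `k - s = l` is
  -- cancelled.
  have key : l * ρ / (eig A s + ρ) ≤ W / ρ := by
    have e : l * (eig A s / (eig A s + ρ)) = l - l * ρ / (eig A s + ρ) := by
      field_simp [(hpos s).ne']
      ring
    have : l = k - s := rfl
    linarith
  rw [div_le_div_iff₀ (hpos s) hρ] at key
  -- Multiply `key` by `l` and absorb the cross term with `2W(lρ) ≤ W² + (lρ)²`.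
  have hq : (l * ρ) ^ 2 ≤ W ^ 2 + 2 * W * (l * eig A s) := by
    have := mul_le_mul_of_nonneg_left key hl.le
    nlinarith [sq_nonneg (l * ρ - W)]
  rw [← Real.sqrt_sq (mul_nonneg hl.le hρ.le), ← Real.sqrt_sq hWpos.le,
    ← Real.sqrt_mul (sq_nonneg _)]
  refine Real.sqrt_le_sqrt (hq.trans ?_)
  have e : (s : ℝ) + stableRank A s - k = stableRank A s - l := by ring
  rw [e, mul_add, mul_one, mul_div_assoc', add_le_add_iff_left, le_div_iff₀ hδ]
  nlinarith [mul_le_mul_of_nonneg_left hW (mul_nonneg (mul_nonneg zero_le_two hWpos.le) hl.le)]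

/-! ### Threshold on `k`, bound on `OPT`, conclusion -/

theorem one_div_le_of_threshold_le {ε x : ℝ} (hε : 0 < ε) (hε' : ε ≤ 1 / 2)
    (hx : 7 / ε ^ 4 * Real.log (1 / ε) ^ 2 ≤ x) : 1 / ε ≤ x := by
  have hlog : (1 : ℝ) / 2 ≤ Real.log (1 / ε) := by
    have h : Real.log 2 ≤ Real.log (1 / ε) :=
      Real.log_le_log two_pos ((le_div_iff₀ hε).mpr (by linarith))
    linarith [Real.log_two_gt_d9]
  refine le_trans ?_ hx
  have h1 : (1 : ℝ) ≤ 7 * Real.log (1 / ε) ^ 2 := by nlinarith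
  have h2 : ε ^ 4 ≤ ε := by
    simpa using pow_le_pow_of_le_one hε.le (by linarith) (show 1 ≤ 4 by norm_num)
  rw [div_mul_eq_mul_div]
  exact div_le_div₀ (by linarith) h1 (by positivity) h2

theorem sum_eig_le_OPT {m n k : ℕ} (A : Matrix (Fin m) (Fin n) ℝ) (hm : k ≤ m) (hn : k ≤ n) :
    ∑ i ∈ Finset.Ico k n, eig A i ≤ OPT A k := by
  -- A competitor of rank `k` is needed because the real infimum of the empty set is `0`.
  obtain ⟨B, hB⟩ := exists_rank_eq hm hn
  refine le_csInf ⟨_, B, hB, rfl⟩ ?_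
  rintro x ⟨C, rfl, rfl⟩
  exact sum_eig_le_frobSq_sub A C


end CSSP

open CSSP

theorem theorem1 {m n : ℕ} (A : Matrix (Fin m) (Fin n) ℝ) (s k : ℕ) (ε : ℝ)
    (hs : s < A.rank) (hε_pos : 0 < ε) (hε_le : ε ≤ 1 / 2)
    (hk_lower : (s : ℝ) + 7 / ε ^ 4 * Real.log (1 / ε) ^ 2 ≤ k)
    (hk_upper : (k : ℝ) ≤ ((s : ℝ) + CSSP.stableRank A s) - 1)
    {Ω : Type*} [MeasurableSpace Ω] (P : Measure Ω) [IsProbabilityMeasure P]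
    (S : Ω → Finset (Fin n)) (hS : HasLaw S (CSSP.kDPP k (Aᵀ * A)) P) :
    0 < CSSP.OPT A k ∧
      (∫ ω, CSSP.Er A (S ω) ∂P) / CSSP.OPT A k ≤ (1 + 2 * ε) ^ 2 * CSSP.Phi A s k := by
  have hkε : 1 / ε ≤ (k : ℝ) - s := one_div_le_of_threshold_le hε_pos hε_le (by linarith)
  have hl : (0 : ℝ) < k - s := (one_div_pos.mpr hε_pos).trans_le hkε
  have hsk : s < k := Nat.cast_lt.mp (sub_pos.mp hl)
  have hsr : (k : ℝ) - s < stableRank A s := by linarith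
  -- If this eigenvalue were `0`, the convention `0⁻¹ = 0` would give stable rank `0`, contradicting
  -- `k - s > 0`.
  have h0 : 0 < eig A s := by
    refine (eig_nonneg A s).lt_of_ne fun h => ?_
    rw [stableRank, ← h, inv_zero, zero_mul] at hsr
    linarith
  have hsn : s < n := hs.trans_le A.rank_le_width
  have hkn : k < n := by
    have h1 : stableRank A s ≤ n - s := by
      rw [stableRank, inv_mul_le_iff₀ h0]
      refine (Finset.sum_le_card_nsmul _ _ (eig A s) fun i hi => ?_).trans_eq ?_
      · exact eig_antitone A (Finset.mem_Ico.mp hi).1 (Finset.mem_Ico.mp hi).2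
      · rw [Nat.card_Ico, nsmul_eq_mul, Nat.cast_sub hsn.le, mul_comm]
    exact Nat.cast_lt.mp (by linarith : (k : ℝ) < n)
  have hW := mul_stableRank_sub_le A hsk.le hkn.le h0
  have hδ : 0 < stableRank A s - (k - s) := sub_pos.mpr hsr
  have hWpos := (mul_pos h0 hδ).trans_le hW
  have hkpos : 0 < eig A k := by
    refine (eig_nonneg A k).lt_of_ne fun h => hWpos.ne' ?_
    refine Finset.sum_eq_zero fun i hi => le_antisymm ?_ (eig_nonneg A i)
    rw [h]
    exact eig_antitone A (Finset.mem_Ico.mp hi).1 (Finset.mem_Ico.mp hi).2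
  -- The tail sum is positive, so `eig A k > 0` and hence `k ≤ rank A ≤ m`.
  have hkm : k ≤ m := (le_rank_of_eig_pos A hkn.le fun i hi =>
    hkpos.trans_le (eig_antitone A hi.le hkn)).trans A.rank_le_height
  have hOPT := sum_eig_le_OPT A hkm hkn.le
  have hOPTpos := hWpos.trans_le hOPT
  refine ⟨hOPTpos, (div_le_iff₀ hOPTpos).mpr ?_⟩
  refine (integral_Er_le A k P S hS).trans ?_
  have hmain := sub_mul_esymm_ratio_le A hsk hkn.le h0 hsr
  rw [Phi]
  set R := √(1 + 2 * ((k : ℝ) - s) / (((s : ℝ) + stableRank A s) - k))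
  set ρ := esymm (Finset.range n) (eig A) (k + 1) / esymm (Finset.range n) (eig A) k
  have hR : 0 ≤ R := Real.sqrt_nonneg _
  have hk1 : (k : ℝ) + 1 ≤ (1 + 2 * ε) ^ 2 * k := by
    have h1 : 1 ≤ ε * k := by
      rw [div_le_iff₀' hε_pos] at hkε
      nlinarith [mul_nonneg hε_pos.le (Nat.cast_nonneg (α := ℝ) s)]
    nlinarith [mul_nonneg (sq_nonneg ε) (Nat.cast_nonneg (α := ℝ) k)]
  have e : (1 : ℝ) + s / (k - s) = k / (k - s) := by
    field_simp
    ring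
  have hρ : ρ ≤ OPT A k * R / (k - s) := by
    rw [le_div_iff₀' hl]
    exact hmain.trans (mul_le_mul_of_nonneg_right hOPT hR)
  rw [e]
  calc ((k : ℝ) + 1) * ρ ≤ ((1 + 2 * ε) ^ 2 * k) * (OPT A k * R / (k - s)) :=
        mul_le_mul hk1 hρ (div_nonneg (esymm_nonneg (fun i _ => eig_nonneg A i) _)
          (esymm_nonneg (fun i _ => eig_nonneg A i) _)) (by positivity)
    _ = (1 + 2 * ε) ^ 2 * (k / (k - s) * R) * OPT A k := by ring
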